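/- **Definitions.** A function $\phi:\mathbb N^n\to\mathbb N$ is *elementary* if it can be generated from the initial functions $2^x$, $\max$, $0$, the successor function and the projections by composition and bounded primitive recursion. A relation on $\mathbb N$ is elementary if its characteristic function is. A function $\mathbb Q\to\mathbb Q$ is elementary if it is represented by an elementary function under the standard coding of rational numbers by natural numbers (a rational is coded by the pair of the codes of the numerator and the denominator of its representation in lowest terms with positive denominator). A function $f:\mathbb N\to\mathbb N$ is *honest* if $f(x)\le f(x+1)$ and $f(x)\ge 2^x$ for all $x\in\mathbb N$, and the relation $f(x)=y$ is elementary. Let $P_i$ be the $i$-th prime ($P_0=2,\ P_1=3,\ldots$), and let $g(0)=1$ and $g(j+1)=P_j^{\,2(j+2)(g(j)+1)^3}$. For an honest function $f$, let $h(i)=g(f(i)+i)$ and $$\alpha^f_n=\sum_{i=0}^n P_i^{-h(i)},\qquad \alpha^f=\lim_{n\to\infty}\alpha^f_n .$$ A function $T:\mathbb Q\to\mathbb Q$ is a *trace function from above* for an irrational number $\beta$ if $\beta<T(q)<q$ for every rational $q>\beta$. **Theorem.** Let $f$ be any honest function. Then the limit $\alpha^f$ exists, and there is an elementary function $\check T:\mathbb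 Q\to\mathbb Q$ such that, for all $q\in\mathbb Q$, (i) $\check T(q)=0$ if $q<\alpha^f$, and (ii) $\alpha^f<\check T(q)<q$ if $q>\alpha^f$. In particular, $\alpha^f$ is irrational and $\check T$ is an elementary trace function from above for $\alpha^f$. -/

import Mathlib

open Filter Topology

namespace Subrec

/-- The elementary functions `ℕⁿ → ℕ`: the least class containing `0`, the successor, the
projections, `2 ^ x` and `max`, closed under composition and bounded primitive recursion. -/
inductive Elementary : {n : ℕ} → ((Fin n → ℕ) → ℕ) → Prop
  | zero : Elementary (n := 0) (fun _ => 0)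
  | succ : Elementary (n := 1) (fun v => v 0 + 1)
  | proj {n : ℕ} (i : Fin n) : Elementary (fun v => v i)
  | twoPow : Elementary (n := 1) (fun v => 2 ^ v 0)
  | max : Elementary (n := 2) (fun v => Max.max (v 0) (v 1))
  | comp {m n : ℕ} {φ : (Fin m → ℕ) → ℕ} {ψ : Fin m → (Fin n → ℕ) → ℕ}
      (hφ : Elementary φ) (hψ : ∀ i, Elementary (ψ i)) :
      Elementary (fun v => φ (fun i => ψ i v))
  | boundedRec {n : ℕ} {base : (Fin n → ℕ) → ℕ} {step : (Fin (n + 2) → ℕ) → ℕ}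
      {bound φ : (Fin (n + 1) → ℕ) → ℕ}
      (hbase : Elementary base) (hstep : Elementary step) (hbound : Elementary bound)
      (h_zero : ∀ v : Fin n → ℕ, φ (Fin.cons 0 v) = base v)
      (h_succ : ∀ (y : ℕ) (v : Fin n → ℕ),
        φ (Fin.cons (y + 1) v) = step (Fin.cons y (Fin.cons (φ (Fin.cons y v)) v)))
      (h_le : ∀ w : Fin (n + 1) → ℕ, φ w ≤ bound w) :
      Elementary φ

/-- A relation on natural numbers is elementary if its `0`-`1`-valued characteristic function is. -/
def ElementaryRel {n : ℕ} (R : (Fin n → ℕ) → Prop) : Prop :=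
  ∃ χ : (Fin n → ℕ) → ℕ, Elementary χ ∧ ∀ v, (R v → χ v = 1) ∧ (¬ R v → χ v = 0)

/-- The code of an integer: `n ↦ 2n` and `-(n + 1) ↦ 2n + 1` for natural numbers `n`. -/
def intCode : ℤ → ℕ
  | Int.ofNat n => 2 * n
  | Int.negSucc n => 2 * n + 1

/-- The code of a rational number: the pair of the codes of the numerator and the denominator of
its representation in lowest terms with positive denominator. -/
def ratCode (q : ℚ) : ℕ := Nat.pair (intCode q.num) q.den

/-- A function on the rationals is elementary if it is so on codes. -/
def ElementaryRat (T : ℚ → ℚ) : Prop :=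
  ∃ φ : (Fin 1 → ℕ) → ℕ, Elementary φ ∧ ∀ q : ℚ, φ (fun _ => ratCode q) = ratCode (T q)

/-- Honest functions: monotone, dominating `2 ^ x`, with elementary graph. -/
structure Honest (f : ℕ → ℕ) : Prop where
  mono : ∀ x, f x ≤ f (x + 1)
  two_pow_le : ∀ x, 2 ^ x ≤ f x
  graph : ElementaryRel (n := 2) (fun v => f (v 0) = v 1)

/-- The `i`-th prime, `P 0 = 2`, `P 1 = 3`, ... -/
noncomputable def P (i : ℕ) : ℕ := Nat.nth Nat.Prime i

noncomputable def g : ℕ → ℕ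
  | 0 => 1
  | j + 1 => P j ^ (2 * (j + 2) * (g j + 1) ^ 3)

noncomputable def h (f : ℕ → ℕ) (i : ℕ) : ℕ := g (f i + i)

noncomputable def alphaSeq (f : ℕ → ℕ) (n : ℕ) : ℚ :=
  ∑ i ∈ Finset.range (n + 1), ((P i : ℚ) ^ h f i)⁻¹

noncomputable def alpha (f : ℕ → ℕ) : ℝ :=
  limUnder atTop (fun n : ℕ => (alphaSeq f n : ℝ))

/-- `T` is a trace function from above for the irrational number `β`. -/
def IsTraceFromAbove (T : ℚ → ℚ) (β : ℝ) : Prop :=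
  Irrational β ∧ ∀ q : ℚ, β < (q : ℝ) → β < (T q : ℝ) ∧ T q < q

end Subrec

/-!
The series `α^f` has lacunary terms: each exponent `h f N` exceeds the product of all preceding
denominators `P i ^ h f i` (`Subrec.Honest.partialDen_le_h`). Given a rational `q` with denominator
`m`, let `N` be the number of exponents that are at most `m`, and write the sum of the first `N`
terms as `A / D`. Both `m` and `D` are at most `h f N`, so the remainder of the series, which is at
most `2 / 2 ^ h f N`, is below `1 / (2 * m * D)` (`Subrec.Honest.alpha_lt`), whereas distinct
fractions with denominators `m` and `D` differ by at least `1 / (m * D)`. Hence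

* if `q ≤ A / D`, then `q < α^f`, as all terms are positive;
* if `A / D < q`, then `α^f < A / D + 1 / (2 * m * D) < q`.

In particular `q ≠ α^f`, so `α^f` is irrational, and `T q = 0` in the first case and
`T q = A / D + 1 / (2 * m * D)` in the second case defines a trace function from above
(`Subrec.trace`, `Subrec.Honest.trace_spec`).

The function `T` is elementary although `f`, `g` and `h f` need not be. Their truncations
`min (f i) b`, `min (g j) b` and `min (h f i) b` are: the first because the graph of `f` is
elementary, the second because `g` can be computed by a recursion that truncates at every step.
Only exponents at most `m` enter the definition of `N`, `A` and `D`, so these are elementary in `m`.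
The closure properties of the elementary functions used here rest on the fact that every elementary
function has a monotone elementary majorant (`Subrec.Elementary.exists_monotone_bound`), which
provides the bounds for bounded sums, and on the fact that a function with elementary graph and
elementary bound is elementary (`Subrec.Elementary.of_graph`).
-/

namespace Subrec

/-! ### Closure properties of the elementary functions -/

namespace Elementary

variable {n : ℕ} {φ ψ : (Fin n → ℕ) → ℕ}

theorem comp₁ {F : ℕ → ℕ} (hF : Elementary (n := 1) fun v => F (v 0)) (hφ : Elementary φ) :
    Elementary fun v => F (φ v) :=
  comp (ψ := ![φ]) hF (by intro i; fin_cases i; exact hφ)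

theorem comp₂ {F : ℕ → ℕ → ℕ} (hF : Elementary (n := 2) fun v => F (v 0) (v 1))
    (hφ : Elementary φ) (hψ : Elementary ψ) : Elementary fun v => F (φ v) (ψ v) :=
  comp (ψ := ![φ, ψ]) hF (by intro i; fin_cases i <;> assumption)

theorem const (n k : ℕ) : Elementary (n := n) fun _ => k := by
  induction k with
  | zero => exact comp (ψ := Fin.elim0) zero (fun i => i.elim0)
  | succ k ih => exact comp₁ (F := (· + 1)) succ ih

theorem comp_tail (hφ : Elementary φ) :
    Elementary (n := n + 1) fun w => φ (Fin.tail w) :=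
  comp hφ fun i => proj i.succ

theorem sup (hφ : Elementary φ) (hψ : Elementary ψ) :
    Elementary fun v => φ v ⊔ ψ v :=
  comp₂ (F := (· ⊔ ·)) max hφ hψ

theorem add_one (hφ : Elementary φ) : Elementary fun v => φ v + 1 :=
  comp₁ (F := (· + 1)) succ hφ

theorem two_pow (hφ : Elementary φ) : Elementary fun v => 2 ^ φ v :=
  comp₁ (F := (2 ^ ·)) twoPow hφ

/-- Bounded primitive recursion on a variable separated from the parameters, the recursion
variable then being replaced by an elementary function of the parameters. -/
theorem primRec {F : ℕ → (Fin n → ℕ) → ℕ} {step : (Fin (n + 2) → ℕ) → ℕ}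
    {bound : (Fin (n + 1) → ℕ) → ℕ}
    (hbase : Elementary (F 0)) (hstep : Elementary step) (hbound : Elementary bound)
    (h_succ : ∀ y v, F (y + 1) v = step (Fin.cons y (Fin.cons (F y v) v)))
    (h_le : ∀ y v, F y v ≤ bound (Fin.cons y v)) (hφ : Elementary φ) :
    Elementary fun v => F (φ v) v := by
  have h : Elementary (n := n + 1) fun w => F (w 0) (Fin.tail w) :=
    boundedRec hbase hstep hbound (fun v => by simp)
      (fun y v => by simpa using h_succ y v)
      (fun w => by simpa using h_le (w 0) (Fin.tail w))
  have := comp (ψ := Fin.cons φ fun i v => v i) h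
    (by intro i; refine Fin.cases ?_ (fun j => ?_) i
        · simpa using hφ
        · simpa using proj j)
  simpa [Fin.tail_def] using this

theorem add (hφ : Elementary φ) (hψ : Elementary ψ) : Elementary fun v => φ v + ψ v := by
  refine comp₂ (F := (· + ·)) ?_ hφ hψ
  refine primRec (F := fun y v => v 0 + y) (step := fun w => w 1 + 1)
    (bound := fun w => 2 ^ ((w 0 ⊔ w 1) + 1)) (proj 0) (proj 1).add_one
    ((sup (proj 0) (proj 1)).add_one.two_pow) (fun y v => rfl) (fun y v => ?_) (proj 1)
  have h1 : y ⊔ v 0 < 2 ^ (y ⊔ v 0) := Nat.lt_two_pow_self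
  have h2 := le_max_left y (v 0)
  have h3 := le_max_right y (v 0)
  have h4 : v 0 + y ≤ 2 ^ ((y ⊔ v 0) + 1) := by rw [pow_succ]; omega
  exact h4

theorem mul (hφ : Elementary φ) (hψ : Elementary ψ) : Elementary fun v => φ v * ψ v := by
  refine comp₂ (F := (· * ·)) ?_ hφ hψ
  refine primRec (F := fun y v => v 0 * y) (step := fun w => w 1 + w 2)
    (bound := fun w => 2 ^ (w 1 + w 0)) (const _ 0) ((proj 1).add (proj 2))
    (((proj 1).add (proj 0)).two_pow) (fun y v => rfl) (fun y v => ?_) (proj 1)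
  have h : v 0 * y ≤ 2 ^ (v 0 + y) := by
    rw [pow_add]
    exact Nat.mul_le_mul Nat.lt_two_pow_self.le Nat.lt_two_pow_self.le
  exact h

theorem pow (hφ : Elementary φ) (hψ : Elementary ψ) : Elementary fun v => φ v ^ ψ v := by
  refine comp₂ (F := (· ^ ·)) ?_ hφ hψ
  refine primRec (F := fun y v => v 0 ^ y) (step := fun w => w 1 * w 2)
    (bound := fun w => 2 ^ (w 1 * w 0)) (const _ 1) ((proj 1).mul (proj 2))
    (((proj 1).mul (proj 0)).two_pow) (fun y v => rfl) (fun y v => ?_) (proj 1)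
  have h : v 0 ^ y ≤ 2 ^ (v 0 * y) := by
    rw [pow_mul]
    exact Nat.pow_le_pow_left Nat.lt_two_pow_self.le _
  exact h

theorem pred (hφ : Elementary φ) : Elementary fun v => φ v - 1 := by
  refine comp₁ (F := (· - 1)) ?_ hφ
  exact primRec (F := fun y _ => y - 1) (step := fun w => w 0)
    (bound := fun w => w 0) (const _ 0) (proj 0) (proj 0) (fun y v => rfl)
    (fun y v => Nat.sub_le y 1) (proj 0)

theorem sub (hφ : Elementary φ) (hψ : Elementary ψ) : Elementary fun v => φ v - ψ v := by
  refine comp₂ (F := (· - ·)) ?_ hφ hψ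
  exact primRec (F := fun y v => v 0 - y) (step := fun w => w 1 - 1)
    (bound := fun w => w 1) (proj 0) (proj 1).pred (proj 1) (fun y v => rfl)
    (fun y v => Nat.sub_le (v 0) y) (proj 1)

/-- Every elementary function has a monotone elementary majorant. This is what makes the bounds
needed for bounded sums and products available. -/
theorem exists_monotone_bound (hφ : Elementary φ) :
    ∃ ψ : (Fin n → ℕ) → ℕ, Elementary ψ ∧ Monotone ψ ∧ ∀ v, φ v ≤ ψ v := by
  induction hφ with
  | zero => exact ⟨_, zero, fun _ _ _ => le_rfl, fun _ => le_rfl⟩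
  | succ => exact ⟨_, succ, fun _ _ h => Nat.succ_le_succ (h 0), fun _ => le_rfl⟩
  | proj i => exact ⟨_, proj i, fun _ _ h => h i, fun _ => le_rfl⟩
  | twoPow =>
    exact ⟨_, twoPow, fun _ _ h => Nat.pow_le_pow_right two_pos (h 0), fun _ => le_rfl⟩
  | max => exact ⟨_, max, fun _ _ h => max_le_max (h 0) (h 1), fun _ => le_rfl⟩
  | comp _ _ ih₁ ih₂ =>
    obtain ⟨b, hb, hbm, hle⟩ := ih₁
    choose c hc hcm hcle using ih₂
    exact ⟨_, comp hb hc, fun _ _ h => hbm fun i => hcm i h,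
      fun v => (hle _).trans (hbm fun i => hcle i v)⟩
  | boundedRec _ _ _ _ _ h_le _ _ ih =>
    obtain ⟨b, hb, hbm, hle⟩ := ih
    exact ⟨b, hb, hbm, fun w => (h_le w).trans (hle w)⟩

theorem sum {F : ℕ → (Fin n → ℕ) → ℕ} (hφ : Elementary φ)
    (hF : Elementary (n := n + 1) fun w => F (w 0) (Fin.tail w)) :
    Elementary fun v => ∑ i ∈ Finset.range (φ v), F i v := by
  obtain ⟨b, hb, hbm, hle⟩ := hF.exists_monotone_bound
  have hstep : Elementary (n := n + 2) fun w => w 1 + F (w 0) (Fin.tail (Fin.tail w)) :=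
    (proj 1).add (comp (ψ := Fin.cons (fun w => w 0) fun i w => w i.succ.succ) hF
      (Fin.cases (proj 0) fun j => proj j.succ.succ))
  refine primRec (F := fun y v => ∑ i ∈ Finset.range y, F i v)
    (bound := fun w => w 0 * b w) (by simpa using const n 0) hstep
    ((proj 0).mul hb) (fun y v => ?_) (fun y v => ?_) hφ
  · simp [Finset.sum_range_succ, Fin.tail_def]
  · refine (Finset.sum_le_card_nsmul _ _ (b (Fin.cons y v)) fun i hi => ?_).trans (by simp)
    refine le_trans (by simpa using hle (Fin.cons i v)) (hbm ?_)
    exact Fin.cons_le_cons.2 ⟨(Finset.mem_range.1 hi).le, le_rfl⟩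

theorem prod {F : ℕ → (Fin n → ℕ) → ℕ} (hφ : Elementary φ)
    (hF : Elementary (n := n + 1) fun w => F (w 0) (Fin.tail w)) :
    Elementary fun v => ∏ i ∈ Finset.range (φ v), F i v := by
  obtain ⟨b, hb, hbm, hle⟩ := hF.exists_monotone_bound
  have hstep : Elementary (n := n + 2) fun w => w 1 * F (w 0) (Fin.tail (Fin.tail w)) :=
    (proj 1).mul (comp (ψ := Fin.cons (fun w => w 0) fun i w => w i.succ.succ) hF
      (Fin.cases (proj 0) fun j => proj j.succ.succ))
  refine primRec (F := fun y v => ∏ i ∈ Finset.range y, F i v)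
    (bound := fun w => b w ^ w 0) (by simpa using const n 1) hstep
    (hb.pow (proj 0)) (fun y v => ?_) (fun y v => ?_) hφ
  · simp [Finset.prod_range_succ, Fin.tail_def]
  · refine (Finset.prod_le_pow_card _ _ (b (Fin.cons y v)) fun i hi => ?_).trans (by simp)
    refine le_trans (by simpa using hle (Fin.cons i v)) (hbm ?_)
    exact Fin.cons_le_cons.2 ⟨(Finset.mem_range.1 hi).le, le_rfl⟩

end Elementary

/-! ### Closure properties of the elementary relations -/

namespace ElementaryRel

open Elementary

variable {n : ℕ} {φ ψ : (Fin n → ℕ) → ℕ} {R S : (Fin n → ℕ) → Prop}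

theorem indicator [DecidablePred R] (hR : ElementaryRel R) :
    Elementary fun v => if R v then 1 else 0 := by
  obtain ⟨χ, hχ, h⟩ := hR
  convert hχ using 2 with v
  split_ifs with hv
  · exact ((h v).1 hv).symm
  · exact ((h v).2 hv).symm

theorem of_iff (hR : ElementaryRel R) (h : ∀ v, S v ↔ R v) : ElementaryRel S := by
  rwa [show S = R from funext fun v => propext (h v)]

theorem le (hφ : Elementary φ) (hψ : Elementary ψ) : ElementaryRel fun v => φ v ≤ ψ v :=
  ⟨_, (const n 1).sub (hφ.sub hψ), fun v => ⟨fun h => by omega, fun h => by omega⟩⟩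

theorem not (hR : ElementaryRel R) : ElementaryRel fun v => ¬ R v := by
  obtain ⟨χ, hχ, h⟩ := hR
  exact ⟨_, (const n 1).sub hχ, fun v => ⟨fun hv => by simp [(h v).2 hv],
    fun hv => by simp [(h v).1 (not_not.1 hv)]⟩⟩

theorem and (hR : ElementaryRel R) (hS : ElementaryRel S) :
    ElementaryRel fun v => R v ∧ S v := by
  obtain ⟨χ, hχ, h⟩ := hR
  obtain ⟨χ', hχ', h'⟩ := hS
  refine ⟨_, hχ.mul hχ', fun v => ⟨fun hv => by simp [(h v).1 hv.1, (h' v).1 hv.2], fun hv => ?_⟩⟩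
  by_cases hv' : R v
  · simp [(h' v).2 fun hs => hv ⟨hv', hs⟩]
  · simp [(h v).2 hv']

theorem or (hR : ElementaryRel R) (hS : ElementaryRel S) :
    ElementaryRel fun v => R v ∨ S v :=
  (hR.not.and hS.not).not.of_iff fun v => by tauto

theorem imp (hR : ElementaryRel R) (hS : ElementaryRel S) :
    ElementaryRel fun v => R v → S v :=
  (hR.not.or hS).of_iff fun v => by tauto

theorem eq (hφ : Elementary φ) (hψ : Elementary ψ) : ElementaryRel fun v => φ v = ψ v :=
  ((le hφ hψ).and (le hψ hφ)).of_iff fun _ => le_antisymm_iff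

theorem lt (hφ : Elementary φ) (hψ : Elementary ψ) : ElementaryRel fun v => φ v < ψ v :=
  le hφ.add_one hψ

theorem comp {m : ℕ} {R : (Fin m → ℕ) → Prop} {ψ : Fin m → (Fin n → ℕ) → ℕ}
    (hR : ElementaryRel R) (hψ : ∀ i, Elementary (ψ i)) :
    ElementaryRel fun v => R fun i => ψ i v := by
  obtain ⟨χ, hχ, h⟩ := hR
  exact ⟨_, hχ.comp hψ, fun v => h _⟩

theorem comp₁ {R : ℕ → Prop} (hR : ElementaryRel (n := 1) fun v => R (v 0)) (hφ : Elementary φ) :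
    ElementaryRel fun v => R (φ v) :=
  hR.comp (ψ := ![φ]) (by intro i; fin_cases i; exact hφ)

theorem comp₂ {R : ℕ → ℕ → Prop} (hR : ElementaryRel (n := 2) fun v => R (v 0) (v 1))
    (hφ : Elementary φ) (hψ : Elementary ψ) : ElementaryRel fun v => R (φ v) (ψ v) :=
  hR.comp (ψ := ![φ, ψ]) (by intro i; fin_cases i <;> assumption)

theorem exists_lt {Q : ℕ → (Fin n → ℕ) → Prop} (hφ : Elementary φ)
    (hQ : ElementaryRel (n := n + 1) fun w => Q (w 0) (Fin.tail w)) :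
    ElementaryRel fun v => ∃ i < φ v, Q i v := by
  classical
  refine (lt (const n 0) (hφ.sum (F := fun i v => if Q i v then 1 else 0) hQ.indicator)).of_iff
    fun v => ?_
  simp [pos_iff_ne_zero]

theorem forall_lt {Q : ℕ → (Fin n → ℕ) → Prop} (hφ : Elementary φ)
    (hQ : ElementaryRel (n := n + 1) fun w => Q (w 0) (Fin.tail w)) :
    ElementaryRel fun v => ∀ i < φ v, Q i v :=
  (exists_lt hφ (Q := fun i v => ¬ Q i v) hQ.not).not.of_iff fun v => by push Not; rfl

theorem dvd (hφ : Elementary φ) (hψ : Elementary ψ) : ElementaryRel fun v => φ v ∣ ψ v := by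
  refine comp₂ (R := (· ∣ ·)) ?_ hφ hψ
  refine (exists_lt (Q := fun c v => v 1 = v 0 * c) (proj 1).add_one
    (eq (proj 2) ((proj 1).mul (proj 0)))).of_iff fun v => ⟨?_, fun ⟨c, _, hc⟩ => ⟨c, hc⟩⟩
  rintro ⟨c, hc⟩
  obtain h0 | h0 := Nat.eq_zero_or_pos (v 0)
  · exact ⟨0, by omega, by simp [hc, h0]⟩
  · exact ⟨c, by rw [hc]; exact Nat.lt_succ_of_le (Nat.le_mul_of_pos_left c h0), hc⟩

theorem prime (hφ : Elementary φ) : ElementaryRel fun v => (φ v).Prime := by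
  refine comp₁ (R := Nat.Prime) ?_ hφ
  exact ((le (const 1 2) (proj 0)).and (forall_lt (Q := fun d v => d ∣ v 0 → d = 1) (proj 0)
    ((dvd (proj 0) (proj 1)).imp (eq (proj 0) (const _ 1))))).of_iff fun v => Nat.prime_def_lt

end ElementaryRel

/-! ### Elementary functions defined by cases or by a bounded graph -/

namespace Elementary

variable {n : ℕ} {φ ψ : (Fin n → ℕ) → ℕ}

theorem ite {R : (Fin n → ℕ) → Prop} [DecidablePred R] (hR : ElementaryRel R) (hφ : Elementary φ)
    (hψ : Elementary ψ) : Elementary fun v => if R v then φ v else ψ v := by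
  convert (hR.indicator.mul hφ).add (((const n 1).sub hR.indicator).mul hψ) using 2 with v
  split_ifs <;> simp

/-- A function with elementary graph and an elementary bound is elementary. -/
theorem of_graph (hψ : Elementary ψ) (h_le : ∀ v, φ v ≤ ψ v)
    (hφ : ElementaryRel (n := n + 1) fun w => φ (Fin.tail w) = w 0) : Elementary φ := by
  convert hψ.add_one.sum (F := fun y v => (if φ v = y then 1 else 0) * y)
    (hφ.indicator.mul (proj 0)) using 2 with v
  simp [Nat.lt_succ_of_le (h_le v)]

theorem inf (hφ : Elementary φ) (hψ : Elementary ψ) : Elementary fun v => φ v ⊓ ψ v := by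
  convert hφ.sub (hφ.sub hψ) using 2 with v
  omega

theorem div (hφ : Elementary φ) (hψ : Elementary ψ) : Elementary fun v => φ v / ψ v := by
  refine comp₂ (F := (· / ·)) ?_ hφ hψ
  have hlt : ElementaryRel (n := 3) fun w => w 0 * w 2 ≤ w 1 ∧ w 1 < (w 0 + 1) * w 2 :=
    ((ElementaryRel.le ((proj 0).mul (proj 2)) (proj 1)).and
      (.lt (proj 1) ((proj 0).add_one.mul (proj 2))))
  have h0 : ElementaryRel (n := 3) fun w => w 2 = 0 ∧ w 0 = 0 :=
    (ElementaryRel.eq (proj 2) (const _ 0)).and (.eq (proj 0) (const _ 0))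
  refine of_graph (proj 0) (fun v => Nat.div_le_self _ _) ((hlt.or h0).of_iff fun w => ?_)
  change w 1 / w 2 = w 0 ↔ _
  obtain h | h := Nat.eq_zero_or_pos (w 2)
  · simp [h, eq_comm]
  · rw [Nat.div_eq_iff h]
    have : (w 0 + 1) * w 2 = w 0 * w 2 + w 2 := by ring
    omega

theorem gcd (hφ : Elementary φ) (hψ : Elementary ψ) :
    Elementary fun v => Nat.gcd (φ v) (ψ v) := by
  refine comp₂ (F := Nat.gcd) ?_ hφ hψ
  have hle (a b : ℕ) : Nat.gcd a b ≤ a + b := by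
    obtain rfl | ha := Nat.eq_zero_or_pos a
    · simp
    · exact (Nat.gcd_le_left b ha).trans (Nat.le_add_right a b)
  have h : ElementaryRel (n := 3) fun w => (w 0 ∣ w 1 ∧ w 0 ∣ w 2) ∧
      ∀ d < w 1 + w 2 + 1, d ∣ w 1 ∧ d ∣ w 2 → d ∣ w 0 :=
    ((ElementaryRel.dvd (proj 0) (proj 1)).and (.dvd (proj 0) (proj 2))).and
      (.forall_lt (Q := fun d w => d ∣ w 1 ∧ d ∣ w 2 → d ∣ w 0)
        ((proj 1).add (proj 2)).add_one
        (((ElementaryRel.dvd (proj 0) (proj 2)).and (.dvd (proj 0) (proj 3))).imp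
          (.dvd (proj 0) (proj 1))))
  refine of_graph ((proj 0).add (proj 1)) (fun v => hle _ _) (h.of_iff fun w => ?_)
  change Nat.gcd (w 1) (w 2) = w 0 ↔ _
  constructor
  · intro hw
    rw [← hw]
    exact ⟨⟨Nat.gcd_dvd_left _ _, Nat.gcd_dvd_right _ _⟩, fun d _ hd => Nat.dvd_gcd hd.1 hd.2⟩
  · rintro ⟨⟨h1, h2⟩, h3⟩
    exact Nat.dvd_antisymm
      (h3 _ (Nat.lt_succ_of_le (hle _ _)) ⟨Nat.gcd_dvd_left _ _, Nat.gcd_dvd_right _ _⟩)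
      (Nat.dvd_gcd h1 h2)

theorem pair (hφ : Elementary φ) (hψ : Elementary ψ) :
    Elementary fun v => Nat.pair (φ v) (ψ v) := by
  unfold Nat.pair
  exact ite (.lt hφ hψ) ((hψ.mul hψ).add hφ) (((hφ.mul hφ).add hφ).add hψ)

theorem unpair_fst (hφ : Elementary φ) : Elementary fun v => (Nat.unpair (φ v)).1 := by
  refine comp₁ (F := fun x => (Nat.unpair x).1) ?_ hφ
  refine of_graph (proj 0) (fun v => Nat.unpair_left_le _)
    ((ElementaryRel.exists_lt (Q := fun z w => Nat.pair (w 0) z = w 1) (proj 1).add_one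
      (.eq ((proj 1).pair (proj 0)) (proj 2))).of_iff fun w => ?_)
  change (Nat.unpair (w 1)).1 = w 0 ↔ _
  constructor
  · intro hw
    exact ⟨_, Nat.lt_succ_of_le (Nat.unpair_right_le (w 1)), by rw [← hw, Nat.pair_unpair]⟩
  · rintro ⟨z, -, hz⟩
    rw [← hz, Nat.unpair_pair]

theorem unpair_snd (hφ : Elementary φ) : Elementary fun v => (Nat.unpair (φ v)).2 := by
  refine comp₁ (F := fun x => (Nat.unpair x).2) ?_ hφ
  refine of_graph (proj 0) (fun v => Nat.unpair_right_le _)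
    ((ElementaryRel.exists_lt (Q := fun z w => Nat.pair z (w 0) = w 1) (proj 1).add_one
      (.eq ((proj 0).pair (proj 1)) (proj 2))).of_iff fun w => ?_)
  change (Nat.unpair (w 1)).2 = w 0 ↔ _
  constructor
  · intro hw
    exact ⟨_, Nat.lt_succ_of_le (Nat.unpair_left_le (w 1)), by rw [← hw, Nat.pair_unpair]⟩
  · rintro ⟨z, -, hz⟩
    rw [← hz, Nat.unpair_pair]

end Elementary

/-! ### The primes -/

theorem prime_P (i : ℕ) : (P i).Prime := Nat.prime_nth_prime i

theorem P_strictMono : StrictMono P := Nat.nth_strictMono Nat.infinite_setOfPred_prime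

theorem P_pos (i : ℕ) : 0 < P i := (prime_P i).pos

theorem two_le_P (i : ℕ) : 2 ≤ P i := (prime_P i).two_le

theorem P_eq_iff {i p : ℕ} : P i = p ↔ p.Prime ∧ Nat.count Nat.Prime p = i := by
  constructor
  · rintro rfl
    exact ⟨prime_P i, Nat.count_nth_of_infinite Nat.infinite_setOfPred_prime i⟩
  · rintro ⟨hp, rfl⟩
    exact Nat.nth_count hp

/-- A consequence of Bertrand's postulate. -/
theorem P_le_two_pow (i : ℕ) : P i ≤ 2 ^ (i + 1) := by
  induction i with
  | zero => simp [P]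
  | succ i ih =>
    obtain ⟨p, hp, hlt, hle⟩ := Nat.exists_prime_lt_and_le_two_mul (P i) (P_pos i).ne'
    have : P (i + 1) ≤ p := by
      rw [← P_eq_iff.2 ⟨hp, rfl⟩] at hlt ⊢
      exact P_strictMono.monotone (P_strictMono.lt_iff_lt.1 hlt)
    rw [pow_succ]
    omega

theorem Elementary.P {n : ℕ} {φ : (Fin n → ℕ) → ℕ} (hφ : Elementary φ) :
    Elementary fun v => Subrec.P (φ v) := by
  refine comp₁ ?_ hφ
  refine of_graph (proj 0).add_one.two_pow (fun v => P_le_two_pow _)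
    (((ElementaryRel.prime (proj 0)).and (.eq ((proj 0).sum
      (F := fun i _ => if i.Prime then 1 else 0) (ElementaryRel.prime (proj 0)).indicator)
      (proj 1))).of_iff fun w => ?_)
  rw [P_eq_iff, Nat.count_eq_card_filter_range, Finset.card_filter]
  rfl

/-! ### The function `g` -/

theorem g_succ (j : ℕ) : g (j + 1) = P j ^ (2 * (j + 2) * (g j + 1) ^ 3) := rfl

/-- The step of the recursion for `g` increases its argument. -/
theorem lt_step (j x : ℕ) : x < P j ^ (2 * (j + 2) * (x + 1) ^ 3) := by
  have h1 : x + 1 ≤ 2 * (j + 2) * (x + 1) ^ 3 :=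
    (Nat.le_self_pow (by omega) _).trans (Nat.le_mul_of_pos_left _ (by omega))
  calc x < 2 ^ x := Nat.lt_two_pow_self
    _ ≤ 2 ^ (2 * (j + 2) * (x + 1) ^ 3) := Nat.pow_le_pow_right two_pos (by omega)
    _ ≤ _ := Nat.pow_le_pow_left (two_le_P j) _

theorem g_strictMono : StrictMono g := strictMono_nat_of_lt_succ fun j => lt_step j (g j)

/-- Although `g` is not elementary, its truncation at a given height is: truncating after every
step of the recursion for `g` does not change the truncated value, and makes the recursion
bounded. -/
theorem elementary_min_g : Elementary (n := 2) fun v => g (v 0) ⊓ v 1 := by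
  have hstep : Elementary (n := 3) fun w =>
      P (w 0) ^ (2 * (w 0 + 2) * (w 1 + 1) ^ 3) ⊓ w 2 := by
    have h2 := Elementary.const 3 2
    have h3 := Elementary.const 3 3
    exact (((Elementary.proj 0).P).pow ((h2.mul ((Elementary.proj 0).add h2)).mul
      ((Elementary.proj 1).add_one.pow h3))).inf (.proj 2)
  have h : Elementary (n := 1 + 1) fun w => g (w 0) ⊓ w 1 := by
    refine .boundedRec (base := fun v => 1 ⊓ v 0) (bound := fun w => w 1)
      ((Elementary.const 1 1).inf (.proj 0)) hstep (.proj 1) (fun v => rfl) (fun y v => ?_)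
      fun w => min_le_right _ _
    change g (y + 1) ⊓ v 0 = P y ^ (2 * (y + 2) * (g y ⊓ v 0 + 1) ^ 3) ⊓ v 0
    obtain hle | hle := le_total (g y) (v 0)
    · rw [min_eq_left hle, g_succ]
    · rw [min_eq_right hle, min_eq_right (hle.trans (g_strictMono.monotone y.le_succ)),
        min_eq_right (lt_step y (v 0)).le]
  exact h

/-! ### The exponents -/

variable {f : ℕ → ℕ}

theorem Honest.monotone (hf : Honest f) : Monotone f := monotone_nat_of_le_succ hf.mono

/-- For the truncation of `f` at `b`, the values below `b` can be searched for in the graph. -/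
theorem Honest.elementary_min (hf : Honest f) : Elementary (n := 2) fun v => f (v 0) ⊓ v 1 := by
  have hG {n : ℕ} {φ ψ : (Fin n → ℕ) → ℕ} (hφ : Elementary φ) (hψ : Elementary ψ) :
      ElementaryRel fun v => f (φ v) = ψ v :=
    ElementaryRel.comp₂ (R := fun x y => f x = y) hf.graph hφ hψ
  have h : ElementaryRel (n := 3) fun w =>
      w 0 < w 2 ∧ f (w 1) = w 0 ∨ w 0 = w 2 ∧ ∀ z < w 2, ¬ f (w 1) = z :=
    ((ElementaryRel.lt (.proj 0) (.proj 2)).and (hG (.proj 1) (.proj 0))).or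
      ((ElementaryRel.eq (.proj 0) (.proj 2)).and
        (.forall_lt (Q := fun z w => ¬ f (w 1) = z) (.proj 2) (hG (.proj 2) (.proj 0)).not))
  refine .of_graph (.proj 1) (fun v => min_le_right _ _) (h.of_iff fun w => ?_)
  change f (w 1) ⊓ w 2 = w 0 ↔ _
  have : (∀ z < w 2, ¬ f (w 1) = z) ↔ w 2 ≤ f (w 1) :=
    ⟨fun h => not_lt.1 fun hlt => h _ hlt rfl, fun h z hz => by omega⟩
  rw [this]
  omega

theorem Honest.h_strictMono (hf : Honest f) : StrictMono (h f) :=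
  g_strictMono.comp (hf.monotone.add_strictMono strictMono_id)

theorem Honest.nine_le_h (hf : Honest f) (i : ℕ) : 9 ≤ h f i := by
  have h1 : 1 ≤ f i + i := le_add_right (Nat.one_le_two_pow.trans (hf.two_pow_le i))
  refine le_trans ?_ (g_strictMono.monotone h1)
  calc 9 ≤ 2 ^ (2 * (0 + 2) * (1 + 1) ^ 3) := by norm_num
    _ ≤ g 1 := Nat.pow_le_pow_left (two_le_P 0) _

/-- Truncating `f i` at `m + 1` before applying `g` does not affect the comparison of `h f i` with
`m`, because `x ≤ g x`. -/
theorem Honest.elementaryRel_h_le (hf : Honest f) :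
    ElementaryRel (n := 2) fun v => h f (v 0) ≤ v 1 := by
  have hb : Elementary (n := 2) fun v => v 1 + 1 := (Elementary.proj 1).add_one
  have hmf : Elementary (n := 2) fun v => f (v 0) ⊓ (v 1 + 1) :=
    .comp₂ (F := fun x y => f x ⊓ y) hf.elementary_min (.proj 0) hb
  have hm : Elementary (n := 2) fun v => g (f (v 0) ⊓ (v 1 + 1) + v 0) ⊓ (v 1 + 1) :=
    .comp₂ (F := fun x y => g x ⊓ y) elementary_min_g (hmf.add (.proj 0)) hb
  refine (ElementaryRel.le hm (.proj 1)).of_iff fun v => ?_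
  obtain hle | hle := le_total (f (v 0)) (v 1 + 1)
  · rw [min_eq_left hle]
    change g (f (v 0) + v 0) ≤ _ ↔ _
    omega
  · have h1 : v 1 + 1 ≤ h f (v 0) := (hle.trans (Nat.le_add_right _ _)).trans g_strictMono.le_apply
    have h2 : v 1 + 1 ≤ g (f (v 0) ⊓ (v 1 + 1) + v 0) := by
      rw [min_eq_right hle]
      exact (Nat.le_add_right _ _).trans g_strictMono.le_apply
    omega

theorem Honest.elementary_min_h (hf : Honest f) : Elementary (n := 2) fun v => h f (v 0) ⊓ v 1 := by
  refine .of_graph (φ := fun v => h f (v 0) ⊓ v 1) (.proj 1) (fun v => min_le_right _ _) ?_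
  have hR {n : ℕ} {φ ψ : (Fin n → ℕ) → ℕ} (hφ : Elementary φ) (hψ : Elementary ψ) :
      ElementaryRel fun v => h f (φ v) ≤ ψ v :=
    ElementaryRel.comp₂ (R := fun x y => h f x ≤ y) hf.elementaryRel_h_le hφ hψ
  -- The truncated value is the least `y ≤ v 1` with `h f (v 0) ≤ y`, or `v 1` if there is none.
  have h : ElementaryRel (n := 3) fun w => w 0 ≤ w 2 ∧
      (h f (w 1) ≤ w 0 ∨ w 0 = w 2) ∧ ∀ z < w 0, ¬ h f (w 1) ≤ z :=
    (ElementaryRel.le (.proj 0) (.proj 2)).and (((hR (.proj 1) (.proj 0)).or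
      (.eq (.proj 0) (.proj 2))).and
        (.forall_lt (Q := fun z w => ¬ h f (w 1) ≤ z) (.proj 0) (hR (.proj 2) (.proj 0)).not))
  refine h.of_iff fun w => ?_
  change Subrec.h f (w 1) ⊓ w 2 = w 0 ↔ _
  have : (∀ z < w 0, ¬ Subrec.h f (w 1) ≤ z) ↔ w 0 ≤ Subrec.h f (w 1) :=
    ⟨fun h => not_lt.1 fun hlt => h _ hlt le_rfl, fun h z hz => by omega⟩
  rw [this]
  omega

/-! ### The partial sums as fractions -/

/-- The product of the denominators of the first `N` terms of the series `α^f`. -/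
noncomputable def partialDen (f : ℕ → ℕ) (N : ℕ) : ℕ := ∏ i ∈ Finset.range N, P i ^ h f i

/-- The numerator of the sum of the first `N` terms of the series `α^f` over the common
denominator `partialDen f N`. -/
noncomputable def partialNum (f : ℕ → ℕ) (N : ℕ) : ℕ :=
  ∑ i ∈ Finset.range N, partialDen f N / P i ^ h f i

/-- The number of indices `i` with `h f i ≤ m`. As `h f` is strictly increasing, these are the
`i` below the first index at which `h f` exceeds `m`. -/
noncomputable def numTerms (f : ℕ → ℕ) (m : ℕ) : ℕ := sInf {N | m < h f N}

theorem partialDen_pos (f : ℕ → ℕ) (N : ℕ) : 0 < partialDen f N :=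
  Finset.prod_pos fun i _ => Nat.pow_pos (P_pos i)

theorem partialNum_div_partialDen {K : Type*} [Field K] [CharZero K] (f : ℕ → ℕ) (N : ℕ) :
    (partialNum f N : K) / partialDen f N = ∑ i ∈ Finset.range N, ((P i : K) ^ h f i)⁻¹ := by
  have hD : (partialDen f N : K) ≠ 0 := Nat.cast_ne_zero.2 (partialDen_pos f N).ne'
  have hP (i : ℕ) : ((P i : K) ^ h f i) ≠ 0 := pow_ne_zero _ (Nat.cast_ne_zero.2 (P_pos i).ne')
  rw [partialNum, Nat.cast_sum, Finset.sum_div]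
  refine Finset.sum_congr rfl fun i hi => ?_
  have hdvd : P i ^ h f i ∣ partialDen f N := Finset.dvd_prod_of_mem _ hi
  rw [Nat.cast_div hdvd (by exact_mod_cast hP i), Nat.cast_pow, div_div_cancel_left' hD]

theorem Honest.lt_numTerms_iff (hf : Honest f) {i m : ℕ} : i < numTerms f m ↔ h f i ≤ m := by
  have hmem : m < h f (numTerms f m) :=
    Nat.sInf_mem (s := {N | m < h f N}) ⟨m + 1, hf.h_strictMono.le_apply (x := m + 1)⟩
  constructor
  · intro hi
    exact not_lt.1 (Nat.notMem_of_lt_sInf (s := {N | m < h f N}) hi)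
  · intro hi
    exact hf.h_strictMono.lt_iff_lt.1 (hi.trans_lt hmem)

theorem Honest.lt_h_numTerms (hf : Honest f) (m : ℕ) : m < h f (numTerms f m) :=
  not_le.1 fun hle => lt_irrefl _ (hf.lt_numTerms_iff.2 hle)

/-- The exponents grow so fast that each of them exceeds the common denominator of all the
preceding terms. -/
theorem Honest.partialDen_le_h (hf : Honest f) (N : ℕ) : partialDen f N ≤ h f N := by
  cases N with
  | zero => simpa [partialDen] using (hf.nine_le_h 0).trans' (by norm_num)
  | succ N =>
    obtain ⟨k, hk⟩ : ∃ k, k = f N + N := ⟨_, rfl⟩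
    have hgk : g k = h f N := by rw [hk]; rfl
    calc partialDen f (N + 1) ≤ (P k ^ g k) ^ (N + 1) := by
          refine (Finset.prod_le_pow_card _ _ (P k ^ g k) fun i hi => ?_).trans (by simp)
          have hi : i ≤ N := Nat.lt_succ_iff.1 (Finset.mem_range.1 hi)
          calc P i ^ h f i ≤ P k ^ h f i :=
                Nat.pow_le_pow_left (P_strictMono.monotone (by omega)) _
            _ ≤ P k ^ g k :=
                Nat.pow_le_pow_right (P_pos k) (hgk ▸ hf.h_strictMono.monotone hi)
      _ = P k ^ (g k * (N + 1)) := by rw [← pow_mul]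
      _ ≤ P k ^ (2 * (k + 2) * (g k + 1) ^ 3) := by
          refine Nat.pow_le_pow_right (P_pos k) ?_
          calc g k * (N + 1) ≤ (g k + 1) ^ 3 * (2 * (k + 2)) :=
                Nat.mul_le_mul ((Nat.le_succ _).trans (Nat.le_self_pow (by omega) _)) (by omega)
            _ = _ := mul_comm _ _
      _ = g (k + 1) := (g_succ k).symm
      _ ≤ h f (N + 1) := g_strictMono.monotone (by have := hf.mono N; omega)

/-! ### The series and its remainders -/

/-- The terms from index `N` on are dominated by a geometric series. -/
theorem Honest.inv_le (hf : Honest f) (N i : ℕ) :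
    ((P (i + N) : ℝ) ^ h f (i + N))⁻¹ ≤ (1 / 2) ^ h f N * (1 / 2) ^ i := by
  have hP : (2 : ℝ) ≤ P (i + N) := by exact_mod_cast two_le_P (i + N)
  have hexp : h f N + i ≤ h f (i + N) := by
    rw [add_comm i N, add_comm (h f N), add_comm N]
    exact hf.h_strictMono.add_le_nat i N
  rw [← pow_add, one_div, inv_pow]
  refine inv_anti₀ (by positivity) ?_
  calc (2 : ℝ) ^ (h f N + i) ≤ 2 ^ h f (i + N) := pow_le_pow_right₀ one_le_two hexp
    _ ≤ _ := pow_le_pow_left₀ zero_le_two hP _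

theorem Honest.summable (hf : Honest f) : Summable fun i => ((P i : ℝ) ^ h f i)⁻¹ :=
  .of_nonneg_of_le (fun i => by positivity) (fun i => hf.inv_le 0 i)
    (summable_geometric_two.mul_left _)

theorem Honest.summable_nat_add (hf : Honest f) (N : ℕ) :
    Summable fun i => ((P (i + N) : ℝ) ^ h f (i + N))⁻¹ :=
  (summable_nat_add_iff (f := fun i => ((P i : ℝ) ^ h f i)⁻¹) N).2 hf.summable

theorem Honest.tendsto_tsum (hf : Honest f) :
    Tendsto (fun n : ℕ => (alphaSeq f n : ℝ)) atTop (𝓝 (∑' i, ((P i : ℝ) ^ h f i)⁻¹)) := by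
  have := (tendsto_add_atTop_iff_nat 1).2 hf.summable.hasSum.tendsto_sum_nat
  simpa [alphaSeq] using this

theorem Honest.alpha_eq_tsum (hf : Honest f) : alpha f = ∑' i, ((P i : ℝ) ^ h f i)⁻¹ :=
  hf.tendsto_tsum.limUnder_eq

theorem Honest.partial_lt_alpha (hf : Honest f) (N : ℕ) :
    (partialNum f N : ℝ) / partialDen f N < alpha f := by
  have hpos (i : ℕ) : 0 < ((P i : ℝ) ^ h f i)⁻¹ :=
    inv_pos.2 (pow_pos (Nat.cast_pos.2 (P_pos i)) _)
  rw [partialNum_div_partialDen, hf.alpha_eq_tsum, ← hf.summable.sum_add_tsum_nat_add N]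
  exact lt_add_of_pos_right _ ((hf.summable_nat_add N).tsum_pos
    (fun i => (hpos _).le) 0 (hpos _))

theorem Honest.alpha_le (hf : Honest f) (N : ℕ) :
    alpha f ≤ (partialNum f N : ℝ) / partialDen f N + (1 / 2) ^ h f N * 2 := by
  rw [partialNum_div_partialDen, hf.alpha_eq_tsum, ← hf.summable.sum_add_tsum_nat_add N]
  gcongr
  calc ∑' i, ((P (i + N) : ℝ) ^ h f (i + N))⁻¹ ≤ ∑' i, (1 / 2) ^ h f N * (1 / 2) ^ i :=
        Summable.tsum_le_tsum (hf.inv_le N) (hf.summable_nat_add N)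
          (summable_geometric_two.mul_left _)
    _ = _ := by rw [tsum_mul_left, tsum_geometric_two]

/-- If `m` is below the exponent of the first omitted term, then the remainder is smaller than
half the least possible distance between distinct fractions with denominators `m` and
`partialDen f N`. -/
theorem Honest.alpha_lt (hf : Honest f) {m N : ℕ} (hm : 0 < m) (hN : m < h f N) :
    alpha f < (2 * m * partialNum f N + 1 : ℝ) / (2 * m * partialDen f N) := by
  have hD := partialDen_pos f N
  have hsq {x : ℕ} (hx : 9 ≤ x) : 4 * (x * x) < 2 ^ x := by
    induction x, hx using Nat.le_induction with
    | base => norm_num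
    | succ x hx ih => rw [pow_succ]; nlinarith
  have hlt : 4 * (m * partialDen f N) < 2 ^ h f N :=
    (Nat.mul_le_mul_left 4 (Nat.mul_le_mul hN.le (hf.partialDen_le_h N))).trans_lt
      (hsq (hf.nine_le_h N))
  have hlt' : 4 * ((m : ℝ) * partialDen f N) < 2 ^ h f N := by exact_mod_cast hlt
  have hm' : (0 : ℝ) < m := by exact_mod_cast hm
  have hD' : (0 : ℝ) < partialDen f N := by exact_mod_cast hD
  refine (hf.alpha_le N).trans_lt ?_
  have heq : (2 * m * partialNum f N + 1 : ℝ) / (2 * m * partialDen f N) =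
      (partialNum f N : ℝ) / partialDen f N + 1 / (2 * (m * partialDen f N)) := by
    field_simp
  rw [heq, one_div_pow]
  gcongr
  rw [one_div_mul_eq_div, div_lt_div_iff₀ (by positivity) (by positivity)]
  linarith

/-! ### The trace function -/

/-- The trace function: with `S` the partial sum of all terms whose exponent is at most the
denominator of `q`, and `D` the common denominator of these terms, its value at `q` is
`S + 1 / (2 * q.den * D)` if `S < q`, and `0` otherwise. -/
noncomputable def trace (f : ℕ → ℕ) (q : ℚ) : ℚ :=
  let A := partialNum f (numTerms f q.den)
  let D := partialDen f (numTerms f q.den)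
  if q.num * D ≤ A * q.den then 0 else (2 * q.den * A + 1 : ℕ) / (2 * q.den * D : ℕ)

theorem num_mul_le_iff (q : ℚ) (A : ℕ) {D : ℕ} (hD : 0 < D) :
    q.num * D ≤ A * q.den ↔ (q : ℝ) ≤ (A : ℝ) / D := by
  have h1 : (0 : ℝ) < q.den := by exact_mod_cast q.pos
  have h2 : (0 : ℝ) < D := by exact_mod_cast hD
  rw [Rat.cast_def, div_le_div_iff₀ h1 h2]
  exact_mod_cast Iff.rfl

/-- Which of the two cases holds depends on whether `q` is at most the partial sum of all terms
whose exponent is at most its denominator. -/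
theorem Honest.trace_spec (hf : Honest f) (q : ℚ) :
    ((q : ℝ) < alpha f ∧ trace f q = 0) ∨ (alpha f < trace f q ∧ trace f q < q) := by
  obtain ⟨N, hN⟩ : ∃ N, N = numTerms f q.den := ⟨_, rfl⟩
  have hlt : q.den < h f N := hN ▸ hf.lt_h_numTerms q.den
  have hD := partialDen_pos f N
  have htr : trace f q = if q.num * partialDen f N ≤ partialNum f N * q.den then 0 else
      ((2 * q.den * partialNum f N + 1 : ℕ) : ℚ) / (2 * q.den * partialDen f N : ℕ) := by
    rw [hN]; rfl
  by_cases hq : q.num * partialDen f N ≤ partialNum f N * q.den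
  · rw [if_pos hq] at htr
    exact .inl ⟨((num_mul_le_iff q _ hD).1 hq).trans_lt (hf.partial_lt_alpha N), htr⟩
  · rw [if_neg hq] at htr
    refine .inr ⟨?_, ?_⟩
    · rw [htr]
      push_cast
      exact hf.alpha_lt q.pos hlt
    · have hden : (0 : ℚ) < q.den := by exact_mod_cast q.pos
      have hD' : (0 : ℚ) < partialDen f N := by exact_mod_cast hD
      -- The difference of the two cross products is a positive integer.
      have hint : partialNum f N * q.den + 1 ≤ q.num * partialDen f N := not_le.1 hq
      have hrat : (partialNum f N * q.den + 1 : ℚ) ≤ q.num * partialDen f N := by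
        exact_mod_cast hint
      rw [htr]
      push_cast
      calc (2 * q.den * partialNum f N + 1 : ℚ) / (2 * q.den * partialDen f N)
          < q.num / q.den := by
            rw [div_lt_div_iff₀ (by positivity) hden]
            nlinarith
        _ = q := q.num_div_den

/-! ### Elementarity of the trace function -/

theorem Honest.elementary_numTerms (hf : Honest f) :
    Elementary (n := 1) fun v => numTerms f (v 0) := by
  have hle (m : ℕ) : numTerms f m ≤ m := by
    have h1 : m + 1 ≤ h f m :=
      le_trans (by have := hf.two_pow_le m; have := Nat.one_le_two_pow (n := m); omega)
        g_strictMono.le_apply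
    exact not_lt.1 fun hlt => by have := hf.lt_numTerms_iff.1 hlt; omega
  have hR {n : ℕ} {φ ψ : (Fin n → ℕ) → ℕ} (hφ : Elementary φ) (hψ : Elementary ψ) :
      ElementaryRel fun v => h f (φ v) ≤ ψ v :=
    ElementaryRel.comp₂ (R := fun x y => h f x ≤ y) hf.elementaryRel_h_le hφ hψ
  have hG : ElementaryRel (n := 2) fun w => ¬ h f (w 0) ≤ w 1 ∧ ∀ i < w 0, h f i ≤ w 1 :=
    (hR (.proj 0) (.proj 1)).not.and
      (.forall_lt (Q := fun i w => h f i ≤ w 1) (.proj 0) (hR (.proj 0) (.proj 2)))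
  refine .of_graph (.proj 0) (fun v => hle _) (hG.of_iff fun w => ?_)
  change numTerms f (w 1) = w 0 ↔ _
  simp only [← hf.lt_numTerms_iff]
  exact ⟨fun h => h ▸ ⟨lt_irrefl _, fun _ => id⟩, fun h => le_antisymm (not_lt.1 h.1)
    (not_lt.1 fun hlt => lt_irrefl _ (h.2 _ hlt))⟩

theorem Honest.elementary_partialDen_numTerms (hf : Honest f) :
    Elementary (n := 1) fun v => partialDen f (numTerms f (v 0)) := by
  -- Only exponents that are at most `v 0` occur, hence truncating them changes nothing.
  have h : Elementary (n := 1) fun v =>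
      ∏ i ∈ Finset.range (numTerms f (v 0)), P i ^ (h f i ⊓ v 0) :=
    .prod (F := fun i v => P i ^ (Subrec.h f i ⊓ v 0)) hf.elementary_numTerms
      ((Elementary.proj 0).P.pow hf.elementary_min_h)
  convert h using 2 with v
  refine Finset.prod_congr rfl fun i hi => ?_
  rw [min_eq_left (hf.lt_numTerms_iff.1 (Finset.mem_range.1 hi))]

theorem Honest.elementary_partialNum_numTerms (hf : Honest f) :
    Elementary (n := 1) fun v => partialNum f (numTerms f (v 0)) := by
  have h : Elementary (n := 1) fun v => ∑ i ∈ Finset.range (numTerms f (v 0)),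
      partialDen f (numTerms f (v 0)) / P i ^ (h f i ⊓ v 0) :=
    .sum (F := fun i v => partialDen f (numTerms f (v 0)) / P i ^ (Subrec.h f i ⊓ v 0))
      hf.elementary_numTerms (hf.elementary_partialDen_numTerms.comp_tail.div
        ((Elementary.proj 0).P.pow hf.elementary_min_h))
  convert h using 2 with v
  refine Finset.sum_congr rfl fun i hi => ?_
  rw [min_eq_left (hf.lt_numTerms_iff.1 (Finset.mem_range.1 hi))]

theorem ratCode_natCast_div (a : ℕ) {b : ℕ} (hb : 0 < b) :
    ratCode ((a : ℚ) / b) = Nat.pair (2 * (a / a.gcd b)) (b / a.gcd b) := by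
  have hgcd : 0 < a.gcd b := Nat.gcd_pos_of_pos_right a hb
  have hb' : 0 < b / a.gcd b := Nat.div_pos (Nat.gcd_le_right a hb) hgcd
  have hcop : (a / a.gcd b).Coprime (b / a.gcd b) := Nat.coprime_div_gcd_div_gcd hgcd
  have heq : (a : ℚ) / b = ((a / a.gcd b : ℕ) : ℤ) / ((b / a.gcd b : ℕ) : ℤ) := by
    have h0 : (a.gcd b : ℚ) ≠ 0 := by exact_mod_cast hgcd.ne'
    rw [Int.cast_natCast, Int.cast_natCast, Nat.cast_div (Nat.gcd_dvd_left a b) h0,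
      Nat.cast_div (Nat.gcd_dvd_right a b) h0, div_div_div_cancel_right₀ h0]
  have hnum : ((a : ℚ) / b).num = (a / a.gcd b : ℕ) := by
    rw [heq]
    exact Rat.num_div_eq_of_coprime (by exact_mod_cast hb') hcop
  have hden : ((a : ℚ) / b).den = b / a.gcd b := by
    have := Rat.den_div_eq_of_coprime (a := (a / a.gcd b : ℕ)) (b := (b / a.gcd b : ℕ))
      (by exact_mod_cast hb') hcop
    rw [heq]
    exact_mod_cast this
  rw [ratCode, hnum, hden]
  rfl

/-- The comparison that defines `trace`, in terms of the code of the numerator: odd codes are those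
of negative integers. -/
theorem num_mul_le_iff_intCode (z : ℤ) (D B : ℕ) :
    z * D ≤ B ↔ ¬ 2 ∣ intCode z ∨ intCode z * D ≤ 2 * B := by
  cases z with
  | ofNat n =>
    have h1 : 2 ∣ intCode (Int.ofNat n) := ⟨n, rfl⟩
    have h2 : intCode (Int.ofNat n) * D = 2 * (n * D) := Nat.mul_assoc 2 n D
    have h3 : Int.ofNat n * D ≤ B ↔ n * D ≤ B := by
      rw [Int.ofNat_eq_natCast]
      exact_mod_cast Iff.rfl
    rw [h3, h2]
    omega
  | negSucc n =>
    have h1 : ¬ 2 ∣ intCode (Int.negSucc n) := by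
      have : intCode (Int.negSucc n) = 2 * n + 1 := rfl
      omega
    have h2 : Int.negSucc n * D ≤ B :=
      (Int.mul_nonpos_of_nonpos_of_nonneg (Int.negSucc_lt_zero n).le (Int.natCast_nonneg D)).trans
        (Int.natCast_nonneg B)
    simp [h1, h2]

theorem Honest.elementaryRat_trace (hf : Honest f) : ElementaryRat (trace f) := by
  let z : (Fin 1 → ℕ) → ℕ := fun v => (Nat.unpair (v 0)).1
  let m : (Fin 1 → ℕ) → ℕ := fun v => (Nat.unpair (v 0)).2
  let A : (Fin 1 → ℕ) → ℕ := fun v => partialNum f (numTerms f (m v))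
  let D : (Fin 1 → ℕ) → ℕ := fun v => partialDen f (numTerms f (m v))
  let a : (Fin 1 → ℕ) → ℕ := fun v => 2 * m v * A v + 1
  let b : (Fin 1 → ℕ) → ℕ := fun v => 2 * m v * D v
  have hz : Elementary z := (Elementary.proj 0).unpair_fst
  have hm : Elementary m := (Elementary.proj 0).unpair_snd
  have hA : Elementary A :=
    .comp₁ (F := fun m => partialNum f (numTerms f m)) hf.elementary_partialNum_numTerms hm
  have hD : Elementary D :=
    .comp₁ (F := fun m => partialDen f (numTerms f m)) hf.elementary_partialDen_numTerms hm
  have h2 : Elementary (n := 1) fun _ => 2 := .const 1 2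
  have ha : Elementary a := ((h2.mul hm).mul hA).add_one
  have hb : Elementary b := (h2.mul hm).mul hD
  refine ⟨_, Elementary.ite (R := fun v => ¬ 2 ∣ z v ∨ z v * D v ≤ 2 * (A v * m v))
    ((ElementaryRel.dvd h2 hz).not.or (.le (hz.mul hD) (h2.mul (hA.mul hm))))
    (.const 1 (ratCode 0)) ((h2.mul (ha.div (ha.gcd hb))).pair (hb.div (ha.gcd hb))),
    fun q => ?_⟩
  have hzq : z (fun _ => ratCode q) = intCode q.num := by simp [z, ratCode]
  have hmq : m (fun _ => ratCode q) = q.den := by simp [m, ratCode]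
  have hpos : 0 < 2 * q.den * partialDen f (numTerms f q.den) :=
    Nat.mul_pos (Nat.mul_pos two_pos q.pos) (partialDen_pos f _)
  have hiff := num_mul_le_iff_intCode q.num (partialDen f (numTerms f q.den))
    (partialNum f (numTerms f q.den) * q.den)
  rw [Nat.cast_mul] at hiff
  simp only [a, b, A, D, hzq, hmq, trace]
  rw [apply_ite ratCode, ratCode_natCast_div _ hpos]
  simp only [hiff]

end Subrec

theorem mainTheorem6 (f : ℕ → ℕ) (hf : Subrec.Honest f) :
    Tendsto (fun n : ℕ => (Subrec.alphaSeq f n : ℝ)) atTop (𝓝 (Subrec.alpha f)) ∧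
    ∃ T : ℚ → ℚ, Subrec.ElementaryRat T ∧
      (∀ q : ℚ, (q : ℝ) < Subrec.alpha f → T q = 0) ∧
      (∀ q : ℚ, Subrec.alpha f < (q : ℝ) →
        Subrec.alpha f < (T q : ℝ) ∧ T q < q) ∧
      Subrec.IsTraceFromAbove T (Subrec.alpha f) := by
  have habove (q : ℚ) (hq : Subrec.alpha f < q) :
      Subrec.alpha f < Subrec.trace f q ∧ Subrec.trace f q < q :=
    (hf.trace_spec q).resolve_left fun h => lt_asymm hq h.1
  refine ⟨hf.alpha_eq_tsum ▸ hf.tendsto_tsum, Subrec.trace f, hf.elementaryRat_trace,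
    fun q hq => ?_, habove, ?_, habove⟩
  · refine ((hf.trace_spec q).resolve_right fun h => ?_).2
    exact lt_asymm hq (h.1.trans (Rat.cast_lt.2 h.2))
  · rintro ⟨q, hq⟩
    obtain h | h := hf.trace_spec q
    · exact h.1.ne hq
    · exact (h.1.trans (Rat.cast_lt.2 h.2)).ne' hq
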